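/- Let $\omega_1,\omega_3\in\mathbb C$ be linearly independent over $\mathbb R$, let $\wp$ be the Weierstrass function with periods $2\omega_1,2\omega_3$, and put $\omega_0=0$, $\omega_2=-\omega_1-\omega_3$, $e_i=\wp(\omega_i)$ $(i=1,2,3)$. Let $M\ge 0$, $l_0,l_1,l_2,l_3\in\mathbb Z_{\ge0}$, $r_1,\dots,r_M\in\mathbb Z_{>0}$, $s_1,\dots,s_M,E\in\mathbb C$, and let $\delta_1,\dots,\delta_M\in\mathbb C$ be non-periods such that the values $b_k=\wp(\delta_k)$ are pairwise distinct and different from $e_1,e_2,e_3$. Set $$v(x)=\sum_{i=0}^3 l_i(l_i+1)\wp(x+\omega_i)+\sum_{k=1}^M\left[\frac{r_k}{2}\Big(\frac{r_k}{2}+1\Big)\big(\wp(x-\delta_k)+\wp(x+\delta_k)\big)+\frac{s_k}{\wp(x)-\wp(\delta_k)}\right],$$ and consider the equations $$\Big(-\frac{d^2}{dx^2}+v(x)-E\Big)f=0\quad(1),\qquad \Xi'''-4(v-E)\Xi'-2v'\,\Xi=0\quad(2).$$ Let $\Psi_g(x)=\prod_{k=1}^M(\wp(x)-\wp(\delta_k))^{r_k/2}$.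 For $\epsilon_1,\epsilon_3\in\{\pm1\}$ let $\tilde{\mathcal F}_{\epsilon_1,\epsilon_3}$ be the space of (possibly two-valued) functions $f$ such that $g=f\Psi_g$ is a meromorphic function on $\mathbb C$ with $g(x+2\omega_j)=\epsilon_j g(x)$ $(j=1,3)$, holomorphic outside $\mathbb Z\omega_1\oplus\mathbb Z\omega_3$, with a pole of order at most $l_i$ at $\omega_i$ $(i=1,2,3)$ and at most $l_0+\sum_k r_k$ at $0$. Assume that the space of even doubly-periodic (i.e. with periods $2\omega_1,2\omega_3$) meromorphic solutions of (2) is one-dimensional, and let $\Xi$ be a nonzero element of it. Then $$Q=\Xi^2(E-v)+\tfrac12\,\Xi\,\Xi''-\tfrac14(\Xi')^2$$ is a constant, and the following hold, where in (ii) and in the last claim of (iii) $\Xi$ is written with constants $c_0,b^{(i)}_j,d^{(k)}_j$ as $$\Xi(x)=c_0+\sum_{i=0}^3\sum_{j=0}^{l_i-1}b^{(i)}_j\,\wp(x+\omega_i)^{l_i-j}+\sum_{k=1}^M\sum_{j=0}^{r_k-1}\frac{d^{(k)}_j}{(\wp(x)-\wp(\delta_k))^{r_k-j}}.$$ (i)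 If (1) has a nonzero solution in $\tilde{\mathcal F}_{\epsilon_1,\epsilon_3}$ for some $\epsilon_1,\epsilon_3\in\{\pm1\}$, then $Q=0$. (ii) If $Q\ne0$ and $l_i\ne0$ $(i\in\{0,1,2,3\})$, then $b^{(i)}_0\ne0$. (iii) If $Q\neq0$ and $l_0=0$, then $\Xi$ is finite and nonzero at $0$, i.e. $\lim_{x\to0}\Xi(x)$ exists and is nonzero. In particular, if $Q\ne0$ and $l_0=l_1=l_2=l_3=0$, then $c_0\ne0$. -/

import Mathlib

open Filter Topology

noncomputable section

/-- The data of the equation `(H - E) f = 0`: a period pair `(2ω₁, 2ω₃)`, the parameters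
`l₀, …, l₃`, `r₁, …, r_M`, `s₁, …, s_M`, the points `δ₁, …, δ_M` and the eigenvalue `E`. -/
structure EllipticSchrodinger (M : ℕ) where
  L : PeriodPair
  l : Fin 4 → ℕ
  r : Fin M → ℕ
  s : Fin M → ℂ
  δ : Fin M → ℂ
  E : ℂ

namespace EllipticSchrodinger

variable {M : ℕ} (D : EllipticSchrodinger M)

/-- The half periods `ω₀ = 0`, `ω₁`, `ω₂ = -ω₁ - ω₃`, `ω₃`; the two periods that Mathlib calls
`D.L.ω₁`, `D.L.ω₂` are `2ω₁` and `2ω₃`. -/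
def halfPeriod : Fin 4 → ℂ :=
  ![0, D.L.ω₁ / 2, -(D.L.ω₁ / 2) - D.L.ω₂ / 2, D.L.ω₂ / 2]

/-- The potential `v`. -/
def v (x : ℂ) : ℂ :=
  ∑ i, (D.l i : ℂ) * ((D.l i : ℂ) + 1) * D.L.weierstrassP (x + D.halfPeriod i)
  + ∑ k, ((D.r k : ℂ) / 2 * ((D.r k : ℂ) / 2 + 1)
        * (D.L.weierstrassP (x - D.δ k) + D.L.weierstrassP (x + D.δ k))
      + D.s k / (D.L.weierstrassP x - D.L.weierstrassP (D.δ k)))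

/-- `ℤ ω₁ ⊕ ℤ ω₃`. -/
def halfLattice : Set ℂ := {x | 2 * x ∈ D.L.lattice}

/-- The complement of `ℤ ω₁ ⊕ ℤ ω₃` and of the points with `℘(x) = ℘(δₖ)` for some `k`, which are
the points congruent to `± δₖ` modulo the periods. -/
def regularSet : Set ℂ :=
  {x | x ∉ D.halfLattice ∧ ∀ k, D.L.weierstrassP x ≠ D.L.weierstrassP (D.δ k)}

/-- The space of even doubly-periodic (meromorphic) solutions of
`Ξ''' - 4 (v - E) Ξ' - 2 v' Ξ = 0`. Such a function is determined by its restriction to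
`regularSet`; it is represented by the extension by zero of this restriction, so that no two
different elements stand for the same meromorphic function. -/
def evenPeriodicSolutions : Submodule ℂ (ℂ → ℂ) where
  carrier := {f | Meromorphic f ∧ AnalyticOnNhd ℂ f D.regularSet ∧
    (∀ x, x ∉ D.regularSet → f x = 0) ∧
    (∀ x, f (-x) = f x) ∧ (∀ x, f (x + D.L.ω₁) = f x) ∧ (∀ x, f (x + D.L.ω₂) = f x) ∧
    ∀ x ∈ D.regularSet,
      iteratedDeriv 3 f x - 4 * (D.v x - D.E) * deriv f x - 2 * deriv D.v x * f x = 0}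
  zero_mem' := by
    refine ⟨Meromorphic.const 0, fun x _ => analyticAt_const, ?_, ?_, ?_, ?_, ?_⟩
    · simp
    · simp
    · simp
    · simp
    · intro x _
      have h0 : (0 : ℂ → ℂ) = fun _ => (0 : ℂ) := rfl
      rw [h0, iteratedDeriv_const]
      simp
  add_mem' := by
    rintro f g ⟨f1, f2, f3, f4, f5, f6, f7⟩ ⟨g1, g2, g3, g4, g5, g6, g7⟩
    refine ⟨f1.add g1, f2.add g2, ?_, ?_, ?_, ?_, ?_⟩
    · intro x hx
      simp [f3 x hx, g3 x hx]
    · intro x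
      simp [f4 x, g4 x]
    · intro x
      simp [f5 x, g5 x]
    · intro x
      simp [f6 x, g6 x]
    · intro x hx
      rw [iteratedDeriv_add (f2 x hx).contDiffAt (g2 x hx).contDiffAt,
        deriv_add (f2 x hx).differentiableAt (g2 x hx).differentiableAt, Pi.add_apply]
      linear_combination f7 x hx + g7 x hx
  smul_mem' := by
    rintro c f ⟨f1, f2, f3, f4, f5, f6, f7⟩
    refine ⟨(Meromorphic.const c).smul f1, fun x hx => analyticAt_const.smul (f2 x hx),
      ?_, ?_, ?_, ?_, ?_⟩
    · intro x hx
      simp [f3 x hx]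
    · intro x
      simp [f4 x]
    · intro x
      simp [f5 x]
    · intro x
      simp [f6 x]
    · intro x hx
      rw [iteratedDeriv_const_smul (f2 x hx).contDiffAt c,
        deriv_const_smul c (f2 x hx).differentiableAt, Pi.smul_apply]
      simp only [smul_eq_mul]
      linear_combination c * f7 x hx

/-- The expression `Ξ² (E - v) + (1/2) Ξ Ξ'' - (1/4) (Ξ')²`. -/
def qExpr (Ξ : ℂ → ℂ) (x : ℂ) : ℂ :=
  Ξ x ^ 2 * (D.E - D.v x) + 1 / 2 * Ξ x * iteratedDeriv 2 Ξ x - 1 / 4 * deriv Ξ x ^ 2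

/-- The expansion
`c₀ + ∑ᵢ ∑_{j < lᵢ} bᵢⱼ ℘(x + ωᵢ)^(lᵢ - j) + ∑ₖ ∑_{j < rₖ} dₖⱼ / (℘(x) - ℘(δₖ))^(rₖ - j)`. -/
def expansion (c₀ : ℂ) (b : Fin 4 → ℕ → ℂ) (d : Fin M → ℕ → ℂ) (x : ℂ) : ℂ :=
  c₀ + ∑ i, ∑ j ∈ Finset.range (D.l i),
      b i j * D.L.weierstrassP (x + D.halfPeriod i) ^ (D.l i - j)
    + ∑ k, ∑ j ∈ Finset.range (D.r k),
      d k j / (D.L.weierstrassP x - D.L.weierstrassP (D.δ k)) ^ (D.r k - j)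

/-- `ψ` is a holomorphic branch on `U` of `Ψ_g = ∏ₖ (℘(x) - ℘(δₖ))^(rₖ/2)`. -/
def IsPsiBranch (U : Set ℂ) (ψ : ℂ → ℂ) : Prop :=
  AnalyticOnNhd ℂ ψ U ∧
    ∀ x ∈ U, ψ x ^ 2 = ∏ k, (D.L.weierstrassP x - D.L.weierstrassP (D.δ k)) ^ D.r k

/-- The possibly two-valued function `f = g / Ψ_g` solves `(H - E) f = 0`, where
`H = - d²/dx² + v`: for every branch of `Ψ_g` on every open set of regular points, the
corresponding branch of `f` satisfies the equation. -/
def QuotientSolves (g : ℂ → ℂ) : Prop :=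
  ∀ (U : Set ℂ) (ψ : ℂ → ℂ), IsOpen U → U ⊆ D.regularSet → D.IsPsiBranch U ψ →
    ∀ x ∈ U, -iteratedDeriv 2 (fun y => g y / ψ y) x + (D.v x - D.E) * (g x / ψ x) = 0

/-- The maximal pole orders at `ω₀, …, ω₃`: `l₀ + ∑ₖ rₖ` at `ω₀ = 0` and `lᵢ` at `ωᵢ`. -/
def poleBound (i : Fin 4) : ℕ := if i = 0 then D.l 0 + ∑ k, D.r k else D.l i

/-- The functions `g = f Ψ_g` for `f` in the space `𝓕̃_{ε₁, ε₃}`. (The elements `f` themselves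
may be two-valued, so they are represented by the single-valued functions `f Ψ_g`.) -/
structure MemTildeF (ε₁ ε₃ : ℤˣ) (g : ℂ → ℂ) : Prop where
  meromorphic : Meromorphic g
  period_one : ∀ x, x ∉ D.halfLattice → g (x + D.L.ω₁) = ((ε₁ : ℤ) : ℂ) * g x
  period_three : ∀ x, x ∉ D.halfLattice → g (x + D.L.ω₂) = ((ε₃ : ℤ) : ℂ) * g x
  holomorphic : AnalyticOnNhd ℂ g D.halfLatticeᶜ
  pole_order : ∀ i, ((-(D.poleBound i : ℤ) : ℤ) : WithTop ℤ) ≤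
    meromorphicOrderAt g (D.halfPeriod i)

end EllipticSchrodinger

end

/-!
The derivative of `Q = Ξ² (E - v) + ½ Ξ Ξ'' - ¼ (Ξ')²` is `½ Ξ` times the left-hand side of the
third order equation, and the regular set is connected because its complement is countable; hence
`Q` is constant (`exists_qExpr_eq`).

If `f = g / Ψ_g` is a nonzero solution of `f'' = (v - E) f` of the given quasi-periodicity, then so
is `f(-x)`, and one of `f(x) ± f(-x)` is nonzero. The square of this function is single-valued, even
and doubly periodic, solves the third order equation, and its first integral `f³ (f'' - (v - E) f)`
vanishes (`MemTildeF.exists_mem_evenPeriodicSolutions`). As the solution space is one-dimensional,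
`Ξ` is proportional to it, so `Q = 0`.

For the remaining claims put `t = x - ωᵢ`. Since `v = lᵢ (lᵢ + 1) / t² + O(1)`, a function
`Ξ = tⁿ h` with `h(ωᵢ) ≠ 0` satisfies `Q = t²ⁿ⁻² (¼ h(ωᵢ)² (n + 2 lᵢ) (n - 2 lᵢ - 2) + O(t))`.
Evenness about `ωᵢ` makes `n` even. For `n ≥ 2` this gives `Q = 0`, and for `n ≤ 0` the constant
term of the bracket must vanish, so `Q ≠ 0` leaves only `n = -2 lᵢ`
(`tendsto_pow_mul_of_firstIntegral_ne_zero`). Comparison with the expansion of `Ξ` identifies the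
leading coefficient at `ωᵢ` with `bᵢ₀` if `lᵢ ≠ 0`, and the value at `0` with `c₀` if all
`lᵢ` vanish.
-/

noncomputable section

/-! ### The Weierstrass function -/

namespace PeriodPair

variable (L : PeriodPair)

lemma weierstrassP_eq_of_sub_mem {x y : ℂ} (h : x - y ∈ L.lattice) :
    L.weierstrassP x = L.weierstrassP y := by
  have := L.weierstrassP_add_coe y ⟨x - y, h⟩
  simpa using this

lemma weierstrassP_eq_of_add_mem {x y : ℂ} (h : x + y ∈ L.lattice) :
    L.weierstrassP x = L.weierstrassP y := by
  rw [← L.weierstrassP_neg y]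
  exact L.weierstrassP_eq_of_sub_mem (by simpa using h)

lemma analyticAt_weierstrassP {x : ℂ} (hx : x ∉ L.lattice) : AnalyticAt ℂ L.weierstrassP x :=
  L.analyticOnNhd_weierstrassP x hx

/-- The summand of `℘` at the lattice point `0` is `1 / x²`, the correction `1 / 0²` being `0`. -/
lemma weierstrassP_eq_except_zero_add (x : ℂ) :
    L.weierstrassP x = L.weierstrassPExcept 0 x + 1 / x ^ 2 := by
  have := L.weierstrassPExcept_add ⟨0, zero_mem _⟩ x
  simpa using this.symm

/-- The pole at `0` shows that `℘ - b` is not the zero function, so its zeros are isolated. -/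
lemma eventually_weierstrassP_ne (b x : ℂ) : ∀ᶠ y in 𝓝[≠] x, L.weierstrassP y ≠ b := by
  have hm : Meromorphic fun y => L.weierstrassP y - b :=
    fun y => (L.meromorphic_weierstrassP y).sub (MeromorphicAt.const b y)
  have h0 : meromorphicOrderAt (fun y => L.weierstrassP y - b) 0 ≠ ⊤ := by
    rw [meromorphicOrderAt_ne_top_iff_eventually_ne_zero (hm 0)]
    have ht := tendsto_cobounded_of_meromorphicOrderAt_neg (f := L.weierstrassP) (x := 0)
      (by rw [L.order_weierstrassP 0 (zero_mem _)]; decide)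
    filter_upwards [ht.eventually_ne_cobounded b] with y hy
    exact sub_ne_zero.2 hy
  have hx := (meromorphicOn_univ.2 hm).meromorphicOrderAt_ne_top_of_isPreconnected
    isPreconnected_univ (Set.mem_univ 0) (Set.mem_univ x) h0
  filter_upwards [(meromorphicOrderAt_ne_top_iff_eventually_ne_zero (hm x)).1 hx] with y hy
  exact sub_ne_zero.1 hy

end PeriodPair

namespace EllipticSchrodinger

variable {M : ℕ} (D : EllipticSchrodinger M)

/-! ### Half periods -/

@[simp] lemma halfPeriod_zero : D.halfPeriod 0 = 0 := rfl

/-- For `i = j` this says that `2ωᵢ` is a period, for `i ≠ j` that the half periods are pairwise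
incongruent modulo the periods. -/
lemma halfPeriod_add_mem_iff (i j : Fin 4) :
    D.halfPeriod i + D.halfPeriod j ∈ D.L.lattice ↔ i = j := by
  have key : ∀ i, D.halfPeriod i = (((![0, 1/2, -1/2, 0] : Fin 4 → ℚ) i : ℚ) : ℂ) * D.L.ω₁
      + (((![0, 0, -1/2, 1/2] : Fin 4 → ℚ) i : ℚ) : ℂ) * D.L.ω₂ := by
    intro i
    fin_cases i <;> simp [halfPeriod] <;> ring
  have hsum : ∀ a b c d : ℚ, (a : ℂ) * D.L.ω₁ + (b : ℂ) * D.L.ω₂ + (c * D.L.ω₁ + d * D.L.ω₂)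
      = ((a + c : ℚ) : ℂ) * D.L.ω₁ + ((b + d : ℚ) : ℂ) * D.L.ω₂ := by
    intros; push_cast; ring
  rw [key i, key j, hsum, PeriodPair.mul_ω₁_add_mul_ω₂_mem_lattice]
  revert i j
  decide +kernel

lemma halfPeriod_notMem {i : Fin 4} (hi : i ≠ 0) : D.halfPeriod i ∉ D.L.lattice := by
  simpa using (D.halfPeriod_add_mem_iff i 0).not.2 hi

/-! ### The regular set -/

lemma sub_notMem_of_mem_regularSet {x : ℂ} (hx : x ∈ D.regularSet) (k : Fin M) :
    x - D.δ k ∉ D.L.lattice :=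
  fun h => hx.2 k (D.L.weierstrassP_eq_of_sub_mem h)

lemma add_notMem_of_mem_regularSet {x : ℂ} (hx : x ∈ D.regularSet) (k : Fin M) :
    x + D.δ k ∉ D.L.lattice :=
  fun h => hx.2 k (D.L.weierstrassP_eq_of_add_mem h)

lemma add_mem_halfLattice_iff {w : ℂ} (hw : w ∈ D.L.lattice) {x : ℂ} :
    x + w ∈ D.halfLattice ↔ x ∈ D.halfLattice := by
  have h2 : 2 * w ∈ D.L.lattice := by rw [two_mul]; exact add_mem hw hw
  simp only [halfLattice, Set.mem_ofPred_eq, mul_add]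
  exact D.L.lattice.add_mem_iff_left h2

lemma neg_mem_halfLattice_iff {x : ℂ} : -x ∈ D.halfLattice ↔ x ∈ D.halfLattice := by
  simp [halfLattice]

lemma halfPeriod_mem_halfLattice (i : Fin 4) : D.halfPeriod i ∈ D.halfLattice := by
  simpa [halfLattice, two_mul] using (D.halfPeriod_add_mem_iff i i).2 rfl

lemma add_halfPeriod_mem_halfLattice_iff {x : ℂ} (i : Fin 4) :
    x + D.halfPeriod i ∈ D.halfLattice ↔ x ∈ D.halfLattice := by
  have h := D.halfPeriod_mem_halfLattice i
  simp only [halfLattice, Set.mem_ofPred_eq, mul_add] at h ⊢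
  exact D.L.lattice.add_mem_iff_left h

lemma mem_halfLattice_of_mem_lattice {x : ℂ} (hx : x ∈ D.L.lattice) : x ∈ D.halfLattice := by
  simpa [halfLattice, two_mul] using add_mem hx hx

lemma add_mem_regularSet_iff {w : ℂ} (hw : w ∈ D.L.lattice) {x : ℂ} :
    x + w ∈ D.regularSet ↔ x ∈ D.regularSet := by
  have : D.L.weierstrassP (x + w) = D.L.weierstrassP x :=
    D.L.weierstrassP_add_coe x ⟨w, hw⟩
  simp [regularSet, D.add_mem_halfLattice_iff hw, this]

lemma neg_mem_regularSet_iff {x : ℂ} : -x ∈ D.regularSet ↔ x ∈ D.regularSet := by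
  simp [regularSet, D.neg_mem_halfLattice_iff]

lemma add_halfPeriod_notMem_of_mem_regularSet {x : ℂ} (hx : x ∈ D.regularSet) (i : Fin 4) :
    x + D.halfPeriod i ∉ D.L.lattice := fun h =>
  hx.1 ((D.add_halfPeriod_mem_halfLattice_iff i).1 (D.mem_halfLattice_of_mem_lattice h))

lemma notMem_lattice_of_mem_regularSet {x : ℂ} (hx : x ∈ D.regularSet) : x ∉ D.L.lattice :=
  fun h => hx.1 (D.mem_halfLattice_of_mem_lattice h)

lemma eventually_mem_regularSet (x : ℂ) : ∀ᶠ y in 𝓝[≠] x, y ∈ D.regularSet := by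
  have h1 : ∀ᶠ y in 𝓝[≠] x, y ∉ D.halfLattice := by
    have hc : ContinuousAt (fun y : ℂ => 2 * y) x := by fun_prop
    have := hc.eventually (D.L.compl_lattice_sdiff_singleton_mem_nhds (2 * x))
    filter_upwards [this.filter_mono nhdsWithin_le_nhds, self_mem_nhdsWithin] with y hy hne hmem
    exact hy ⟨hmem, fun h => hne (mul_left_cancel₀ two_ne_zero h)⟩
  have h2 : ∀ᶠ y in 𝓝[≠] x, ∀ k, D.L.weierstrassP y ≠ D.L.weierstrassP (D.δ k) :=
    eventually_all.2 fun k => D.L.eventually_weierstrassP_ne _ x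
  filter_upwards [h1, h2] with y hy1 hy2 using ⟨hy1, hy2⟩

lemma regularSet_mem_codiscrete : D.regularSet ∈ codiscrete ℂ := by
  rw [mem_codiscrete]
  intro x
  rw [disjoint_principal_right, compl_compl]
  exact D.eventually_mem_regularSet x

lemma isOpen_regularSet : IsOpen D.regularSet :=
  (mem_codiscrete'.1 D.regularSet_mem_codiscrete).1

lemma isConnected_regularSet : IsConnected D.regularSet := by
  have h : D.regularSetᶜ.Countable :=
    (HereditarilyLindelofSpace.isLindelof _).countable_of_isDiscrete
      (mem_codiscrete'.1 D.regularSet_mem_codiscrete).2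
  simpa using h.isConnected_compl_of_one_lt_rank (by simp)

/-! ### The potential -/

lemma analyticAt_v {x : ℂ} (hx : x ∈ D.regularSet) : AnalyticAt ℂ D.v x := by
  have h1 : ∀ i, AnalyticAt ℂ (fun y => D.L.weierstrassP (y + D.halfPeriod i)) x := fun i =>
    AnalyticAt.fun_comp (g := D.L.weierstrassP) (f := fun y => y + D.halfPeriod i)
      (D.L.analyticAt_weierstrassP (D.add_halfPeriod_notMem_of_mem_regularSet hx i)) (by fun_prop)
  have h2 : ∀ k, AnalyticAt ℂ (fun y => D.L.weierstrassP (y - D.δ k)) x := fun k =>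
    AnalyticAt.fun_comp (g := D.L.weierstrassP) (f := fun y => y - D.δ k)
      (D.L.analyticAt_weierstrassP (D.sub_notMem_of_mem_regularSet hx k)) (by fun_prop)
  have h3 : ∀ k, AnalyticAt ℂ (fun y => D.L.weierstrassP (y + D.δ k)) x := fun k =>
    AnalyticAt.fun_comp (g := D.L.weierstrassP) (f := fun y => y + D.δ k)
      (D.L.analyticAt_weierstrassP (D.add_notMem_of_mem_regularSet hx k)) (by fun_prop)
  have h4 := D.L.analyticAt_weierstrassP (D.notMem_lattice_of_mem_regularSet hx)
  refine AnalyticAt.fun_add (Finset.analyticAt_fun_sum _ fun i _ => analyticAt_const.mul (h1 i))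
    (Finset.analyticAt_fun_sum _ fun k _ => AnalyticAt.fun_add
      (analyticAt_const.mul ((h2 k).add (h3 k)))
      (analyticAt_const.div (h4.sub analyticAt_const) (sub_ne_zero.2 (hx.2 k))))

lemma v_neg (x : ℂ) : D.v (-x) = D.v x := by
  unfold v
  congr 1
  · refine Finset.sum_congr rfl fun i _ => ?_
    congr 1
    rw [← D.L.weierstrassP_neg]
    refine D.L.weierstrassP_eq_of_sub_mem ?_
    have := neg_mem ((D.halfPeriod_add_mem_iff i i).2 rfl)
    convert this using 1
    ring
  · refine Finset.sum_congr rfl fun k _ => ?_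
    rw [D.L.weierstrassP_neg x, ← D.L.weierstrassP_neg (-x - D.δ k),
      ← D.L.weierstrassP_neg (-x + D.δ k)]
    ring_nf

/-! ### The first integral of the third order equation -/

/-- `Q' = ½ Ξ (Ξ''' - 4 (v - E) Ξ' - 2 v' Ξ)`, so `Q` is constant on the connected regular set. -/
lemma exists_qExpr_eq {Ξ : ℂ → ℂ} (hΞ : Ξ ∈ D.evenPeriodicSolutions) :
    ∃ Q : ℂ, ∀ x ∈ D.regularSet, D.qExpr Ξ x = Q := by
  obtain ⟨-, han, -, -, -, -, hode⟩ := hΞ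
  have hd : ∀ x ∈ D.regularSet, HasDerivAt (D.qExpr Ξ) 0 x := by
    intro x hx
    have h0 := (han x hx).differentiableAt.hasDerivAt
    have h1 := (han x hx).deriv.differentiableAt.hasDerivAt
    have h2 := (han x hx).deriv.deriv.differentiableAt.hasDerivAt
    have hv := (D.analyticAt_v hx).differentiableAt.hasDerivAt
    have ho := hode x hx
    simp only [iteratedDeriv_succ, iteratedDeriv_zero] at ho
    have hq : D.qExpr Ξ = fun x => Ξ x ^ 2 * (D.E - D.v x)
        + 1 / 2 * Ξ x * deriv (deriv Ξ) x - 1 / 4 * deriv Ξ x ^ 2 := by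
      funext y; simp only [qExpr, iteratedDeriv_succ, iteratedDeriv_zero]
    rw [hq]
    refine ((((h0.fun_pow 2).fun_mul (hv.const_sub D.E)).fun_add
      ((h0.const_mul (1 / 2)).fun_mul h2)).fun_sub ((h1.fun_pow 2).const_mul (1 / 4))).congr_deriv
      ?_
    push_cast
    linear_combination (1 / 2 * Ξ x) * ho
  exact D.isOpen_regularSet.exists_is_const_of_deriv_eq_zero D.isConnected_regularSet.isPreconnected
    (fun x hx => (hd x hx).differentiableAt.differentiableWithinAt) fun x hx => (hd x hx).deriv

end EllipticSchrodinger

/-! ### Local analysis of the first integral -/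

/-- The exponent of an even function at its centre of symmetry is even. -/
lemma even_of_zpow_mul_symmetric {Ξ h : ℂ → ℂ} {p : ℂ} {n : ℤ} (hh : AnalyticAt ℂ h p)
    (hp : h p ≠ 0) (hΞ : ∀ᶠ x in 𝓝[≠] p, Ξ x = (x - p) ^ n * h x)
    (hsym : ∀ t, Ξ (p + t) = Ξ (p - t)) : Even n := by
  by_contra hn
  rw [Int.not_even_iff_odd] at hn
  have ht1 : Tendsto (fun t : ℂ => p + t) (𝓝[≠] 0) (𝓝[≠] p) := by
    refine tendsto_nhdsWithin_iff.2 ⟨?_, ?_⟩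
    · exact tendsto_nhdsWithin_of_tendsto_nhds
        (by simpa using (continuous_const_add p).tendsto (0 : ℂ))
    · filter_upwards [self_mem_nhdsWithin] with t ht
      simpa using ht
  have ht2 : Tendsto (fun t : ℂ => p - t) (𝓝[≠] 0) (𝓝[≠] p) := by
    refine tendsto_nhdsWithin_iff.2 ⟨?_, ?_⟩
    · exact tendsto_nhdsWithin_of_tendsto_nhds
        (by simpa using (continuous_sub_left p).tendsto (0 : ℂ))
    · filter_upwards [self_mem_nhdsWithin] with t ht
      simpa using ht
  have heq : ∀ᶠ t in 𝓝[≠] (0 : ℂ), h (p + t) = -h (p - t) := by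
    filter_upwards [ht1.eventually hΞ, ht2.eventually hΞ, self_mem_nhdsWithin] with t h1 h2 ht
    have := hsym t
    rw [h1, h2, add_sub_cancel_left, sub_sub_cancel_left, hn.neg_zpow] at this
    have hz : t ^ n ≠ 0 := zpow_ne_zero _ ht
    refine mul_left_cancel₀ hz ?_
    linear_combination this
  have hc := hh.continuousAt.tendsto.mono_left (nhdsWithin_le_nhds (s := {p}ᶜ))
  have hlim := tendsto_nhds_unique ((hc.comp ht1).congr' heq) (hc.comp ht2).neg
  exact hp (self_eq_neg.1 hlim)

/-- Write `Ξ = tⁿ h` with `h(p) ≠ 0` near `p`, where `t = x - p`. The first integral is then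
`t²ⁿ⁻²` times an analytic function whose value at `p` is `¼ h(p)² (n + 2l) (n - 2l - 2)`. As `n` is
even and the first integral is a nonzero constant, this forces `n = -2l`. -/
theorem tendsto_pow_mul_of_firstIntegral_ne_zero {Ξ v w : ℂ → ℂ} {p E Q : ℂ} {l : ℕ}
    (hmer : MeromorphicAt Ξ p) (hsym : ∀ t, Ξ (p + t) = Ξ (p - t)) (hw : AnalyticAt ℂ w p)
    (hv : ∀ᶠ x in 𝓝[≠] p, v x = l * (l + 1) / (x - p) ^ 2 + w x)
    (hQ : ∀ᶠ x in 𝓝[≠] p, Ξ x ^ 2 * (E - v x) + 1 / 2 * Ξ x * deriv (deriv Ξ) x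
      - 1 / 4 * deriv Ξ x ^ 2 = Q) (hQ0 : Q ≠ 0) :
    ∃ a : ℂ, a ≠ 0 ∧ Tendsto (fun x => (x - p) ^ (2 * l) * Ξ x) (𝓝[≠] p) (𝓝 a) := by
  -- If `Ξ` vanished identically near `p`, then so would the first integral.
  have htop : meromorphicOrderAt Ξ p ≠ ⊤ := by
    intro htop
    rw [meromorphicOrderAt_eq_top_iff] at htop
    have h2 := eventually_eventually_nhdsWithin.2 htop
    obtain ⟨x, hx, hz, hxp⟩ := (hQ.and (h2.and self_mem_nhdsWithin)).exists
    have hz' : Ξ =ᶠ[𝓝 x] fun _ => 0 := by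
      rwa [(isOpen_compl_singleton).nhdsWithin_eq hxp] at hz
    apply hQ0
    rw [← hx, hz'.eq_of_nhds, hz'.deriv_eq]
    simp
  obtain ⟨h, hh, hp, hΞ⟩ := (meromorphicOrderAt_ne_top_iff hmer).1 htop
  set n := (meromorphicOrderAt Ξ p).untop₀
  simp only [smul_eq_mul] at hΞ
  have hnEven := even_of_zpow_mul_symmetric hh hp hΞ hsym
  -- The cofactor of `t²ⁿ⁻²` in the first integral.
  set K : ℂ → ℂ := fun x => h x ^ 2 * (1 / 4 * (n + 2 * l) * (n - 2 * l - 2))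
    + (x - p) * ((x - p) * h x ^ 2 * (E - w x) + 1 / 2 * n * h x * deriv h x
      + (x - p) * (1 / 2 * h x * deriv (deriv h) x - 1 / 4 * deriv h x ^ 2)) with hK
  have hKeq : ∀ᶠ x in 𝓝[≠] p, Q = (x - p) ^ (2 * n - 2) * K x := by
    filter_upwards [hQ, hv, eventually_eventually_nhdsWithin.2 hΞ,
      hh.eventually_analyticAt.filter_mono nhdsWithin_le_nhds, self_mem_nhdsWithin]
      with x hQx hvx hΞx hhx hxp
    rw [(isOpen_compl_singleton).nhdsWithin_eq hxp] at hΞx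
    have ht : x - p ≠ 0 := sub_ne_zero.2 hxp
    have hzpow : ∀ (m : ℤ) (y : ℂ), y - p ≠ 0 →
        HasDerivAt (fun x => (x - p) ^ m) (m * (y - p) ^ (m - 1)) y :=
      fun m y hy => (hasDerivAt_zpow m (y - p) (Or.inl hy)).comp_sub_const y p
    have hd1 : ∀ y, AnalyticAt ℂ h y → y - p ≠ 0 → HasDerivAt (fun x => (x - p) ^ n * h x)
        (n * (y - p) ^ (n - 1) * h y + (y - p) ^ n * deriv h y) y := by
      intro y hy hyp
      exact (hzpow n y hyp).fun_mul hy.differentiableAt.hasDerivAt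
    have hΞ1 : deriv Ξ =ᶠ[𝓝 x]
        fun y => n * (y - p) ^ (n - 1) * h y + (y - p) ^ n * deriv h y := by
      filter_upwards [hΞx.eventually_nhds, hhx.eventually_analyticAt,
        isOpen_compl_singleton.mem_nhds hxp] with y hy hhy hyp
      exact (EventuallyEq.deriv_eq hy).trans (hd1 y hhy (sub_ne_zero.2 hyp)).deriv
    have hd2 : HasDerivAt (fun y => n * (y - p) ^ (n - 1) * h y + (y - p) ^ n * deriv h y)
        (n * ((n - 1) * (x - p) ^ (n - 2)) * h x + n * (x - p) ^ (n - 1) * deriv h x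
          + (n * (x - p) ^ (n - 1) * deriv h x + (x - p) ^ n * deriv (deriv h) x)) x := by
      have e1 := ((hzpow (n - 1) x ht).const_mul (n : ℂ)).fun_mul hhx.differentiableAt.hasDerivAt
      have e2 := (hzpow n x ht).fun_mul hhx.deriv.differentiableAt.hasDerivAt
      refine (e1.fun_add e2).congr_deriv ?_
      rw [sub_sub, one_add_one_eq_two]
      push_cast
      ring
    have hΞx' : Ξ x = (x - p) ^ n * h x := EventuallyEq.eq_of_nhds hΞx
    rw [hvx, hΞx', hΞ1.deriv_eq, hΞ1.eq_of_nhds, hd2.deriv] at hQx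
    rw [← hQx, hK]
    have z1 : (x - p) ^ (n - 1) = (x - p) ^ n / (x - p) := by rw [zpow_sub_one₀ ht, div_eq_mul_inv]
    have z2 : (x - p) ^ (n - 2) = (x - p) ^ n / (x - p) ^ 2 := by
      rw [zpow_sub₀ ht]; norm_cast
    have z3 : (x - p) ^ (2 * n - 2) = ((x - p) ^ n) ^ 2 / (x - p) ^ 2 := by
      rw [zpow_sub₀ ht, mul_comm 2 n, zpow_mul]; norm_cast
    rw [z1, z2, z3]
    generalize (x - p) ^ n = T
    field_simp
    ring
  have hKc : ContinuousAt K p := by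
    have c0 := hh.continuousAt
    have c1 := hh.deriv.continuousAt
    have c2 := hh.deriv.deriv.continuousAt
    have c3 := hw.continuousAt
    rw [hK]
    fun_prop
  have hKlim : Tendsto K (𝓝[≠] p) (𝓝 (K p)) := hKc.tendsto.mono_left nhdsWithin_le_nhds
  have hKp : K p = h p ^ 2 * (1 / 4 * (n + 2 * l) * (n - 2 * l - 2)) := by simp [hK]
  have hsub : Tendsto (fun x : ℂ => x - p) (𝓝[≠] p) (𝓝 0) :=
    tendsto_nhdsWithin_of_tendsto_nhds (by simpa using (continuous_sub_right p).tendsto p)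
  have hpow : ∀ m : ℕ, m ≠ 0 → Tendsto (fun x : ℂ => (x - p) ^ m) (𝓝[≠] p) (𝓝 0) :=
    fun m hm => by simpa [hm] using hsub.pow m
  have hn : n = -(2 * l : ℤ) := by
    rcases lt_or_ge n 1 with hlt | hge
    · -- Here `K = t²⁻²ⁿ Q` tends to `0`, so `n` is a root of `(n + 2l) (n - 2l - 2)`.
      obtain ⟨m, hm⟩ := Int.eq_ofNat_of_zero_le (show 0 ≤ 2 - 2 * n by lia)
      have h0 : Tendsto K (𝓝[≠] p) (𝓝 0) := by
        have := (hpow m (by lia)).mul_const Q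
        rw [zero_mul] at this
        refine this.congr' ?_
        filter_upwards [hKeq, self_mem_nhdsWithin] with x hx hxp
        have ht : x - p ≠ 0 := sub_ne_zero.2 hxp
        rw [hx, ← mul_assoc, ← zpow_natCast, ← zpow_add₀ ht,
          show (m : ℤ) + (2 * n - 2) = 0 by lia, zpow_zero, one_mul]
      have hz := tendsto_nhds_unique hKlim h0
      rw [hKp] at hz
      have hz2 : ((n + 2 * l : ℤ) : ℂ) * ((n - 2 * l - 2 : ℤ) : ℂ) = 0 := by
        have := (mul_eq_zero.1 hz).resolve_left (pow_ne_zero 2 hp)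
        push_cast
        linear_combination 4 * this
      rcases mul_eq_zero.1 hz2 with h | h
      · have := Int.cast_eq_zero.1 h; lia
      · have := Int.cast_eq_zero.1 h; lia
    · -- Here `n ≥ 2`, so that the first integral tends to `0`.
      obtain ⟨m, hm⟩ := Int.eq_ofNat_of_zero_le (show 0 ≤ 2 * n - 2 by lia)
      have hm0 : m ≠ 0 := by
        obtain ⟨r, hr⟩ := hnEven
        lia
      have h0 := (hpow m hm0).mul hKlim
      rw [zero_mul] at h0
      refine absurd (tendsto_nhds_unique ?_ h0) hQ0
      refine tendsto_const_nhds.congr' ?_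
      filter_upwards [hKeq] with x hx
      rw [hx, hm]; exact congrArg (· * K x) (zpow_natCast _ m).symm
  refine ⟨h p, hp, (hh.continuousAt.tendsto.mono_left nhdsWithin_le_nhds).congr' ?_⟩
  filter_upwards [hΞ, self_mem_nhdsWithin] with x hx hxp
  have ht : x - p ≠ 0 := sub_ne_zero.2 hxp
  rw [hx, hn, ← mul_assoc, ← zpow_natCast, ← zpow_add₀ ht]
  simp

namespace EllipticSchrodinger

variable {M : ℕ} (D : EllipticSchrodinger M)

/-! ### Behaviour at the half periods -/

lemma halfPeriod_sub_notMem (hδ : ∀ k, D.δ k ∉ D.L.lattice)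
    (he : ∀ k, ∀ i, i ≠ 0 → D.L.weierstrassP (D.δ k) ≠ D.L.weierstrassP (D.halfPeriod i))
    (i : Fin 4) (k : Fin M) : D.halfPeriod i - D.δ k ∉ D.L.lattice := by
  intro h
  rcases eq_or_ne i 0 with rfl | hi
  · exact hδ k (by simpa using h)
  · exact he k i hi (D.L.weierstrassP_eq_of_sub_mem h).symm

lemma halfPeriod_add_notMem (hδ : ∀ k, D.δ k ∉ D.L.lattice)
    (he : ∀ k, ∀ i, i ≠ 0 → D.L.weierstrassP (D.δ k) ≠ D.L.weierstrassP (D.halfPeriod i))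
    (i : Fin 4) (k : Fin M) : D.halfPeriod i + D.δ k ∉ D.L.lattice := by
  intro h
  rcases eq_or_ne i 0 with rfl | hi
  · exact hδ k (by simpa using h)
  · exact he k i hi (D.L.weierstrassP_eq_of_add_mem h).symm

lemma weierstrassP_add_halfPeriod (i : Fin 4) (x : ℂ) :
    D.L.weierstrassP (x + D.halfPeriod i) =
      D.L.weierstrassPExcept 0 (x - D.halfPeriod i) + 1 / (x - D.halfPeriod i) ^ 2 := by
  rw [← D.L.weierstrassP_eq_except_zero_add]
  refine D.L.weierstrassP_eq_of_sub_mem ?_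
  have := (D.halfPeriod_add_mem_iff i i).2 rfl
  convert this using 1
  ring

lemma analyticAt_weierstrassPExcept_sub (p : ℂ) :
    AnalyticAt ℂ (fun x => D.L.weierstrassPExcept 0 (x - p)) p :=
  AnalyticAt.fun_comp (g := D.L.weierstrassPExcept 0) (f := fun x => x - p)
    (by rw [sub_self]; exact D.L.analyticAt_weierstrassPExcept 0) (by fun_prop)

lemma analyticAt_weierstrassP_add_halfPeriod {i j : Fin 4} (hij : i ≠ j) :
    AnalyticAt ℂ (fun x => D.L.weierstrassP (x + D.halfPeriod j)) (D.halfPeriod i) :=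
  AnalyticAt.fun_comp (g := D.L.weierstrassP) (f := fun x => x + D.halfPeriod j)
    (D.L.analyticAt_weierstrassP ((D.halfPeriod_add_mem_iff i j).not.2 hij)) (by fun_prop)

/-- `1 / (℘ - ℘(δₖ))` extends analytically to each half period, with a zero at the lattice point
`0`, where `℘` has a pole. -/
lemma exists_analyticAt_one_div_weierstrassP_sub
    (he : ∀ k, ∀ i, i ≠ 0 → D.L.weierstrassP (D.δ k) ≠ D.L.weierstrassP (D.halfPeriod i))
    (i : Fin 4) (k : Fin M) :
    ∃ w : ℂ → ℂ, AnalyticAt ℂ w (D.halfPeriod i) ∧ (i = 0 → w 0 = 0) ∧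
      ∀ᶠ x in 𝓝[≠] (D.halfPeriod i),
        1 / (D.L.weierstrassP x - D.L.weierstrassP (D.δ k)) = w x := by
  set c := D.L.weierstrassP (D.δ k)
  rcases eq_or_ne i 0 with rfl | hi
  · have ha : AnalyticAt ℂ (D.L.weierstrassPExcept 0) 0 := D.L.analyticAt_weierstrassPExcept 0
    refine ⟨fun x => x ^ 2 / (x ^ 2 * (D.L.weierstrassPExcept 0 x - c) + 1), ?_, by simp, ?_⟩
    · rw [D.halfPeriod_zero]
      refine AnalyticAt.fun_div (by fun_prop) (by fun_prop) (by simp)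
    · rw [D.halfPeriod_zero]
      filter_upwards [self_mem_nhdsWithin, D.L.eventually_weierstrassP_ne c 0] with x hx hne
      have hx0 : x ≠ 0 := hx
      rw [← mul_div_mul_left _ _ (pow_ne_zero 2 hx0), D.L.weierstrassP_eq_except_zero_add]
      congr 1
      · ring
      · field_simp
        ring
  · refine ⟨fun x => 1 / (D.L.weierstrassP x - c), ?_, fun h => absurd h hi,
      Eventually.of_forall fun _ => rfl⟩
    exact analyticAt_const.div
      ((D.L.analyticAt_weierstrassP (D.halfPeriod_notMem hi)).sub analyticAt_const)
      (sub_ne_zero.2 (he k i hi).symm)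

/-- The potential has the principal part `lᵢ (lᵢ + 1) / (x - ωᵢ)²` at `ωᵢ`. -/
lemma exists_v_eq_near_halfPeriod (hδ : ∀ k, D.δ k ∉ D.L.lattice)
    (he : ∀ k, ∀ i, i ≠ 0 → D.L.weierstrassP (D.δ k) ≠ D.L.weierstrassP (D.halfPeriod i))
    (i : Fin 4) :
    ∃ w : ℂ → ℂ, AnalyticAt ℂ w (D.halfPeriod i) ∧ ∀ᶠ x in 𝓝[≠] (D.halfPeriod i),
      D.v x = (D.l i : ℂ) * ((D.l i : ℂ) + 1) / (x - D.halfPeriod i) ^ 2 + w x := by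
  choose u hu _ hueq using fun k => D.exists_analyticAt_one_div_weierstrassP_sub he i k
  refine ⟨fun x => (D.l i : ℂ) * ((D.l i : ℂ) + 1) * D.L.weierstrassPExcept 0 (x - D.halfPeriod i)
    + ∑ j ∈ Finset.univ.erase i,
        (D.l j : ℂ) * ((D.l j : ℂ) + 1) * D.L.weierstrassP (x + D.halfPeriod j)
    + ∑ k, ((D.r k : ℂ) / 2 * ((D.r k : ℂ) / 2 + 1)
        * (D.L.weierstrassP (x - D.δ k) + D.L.weierstrassP (x + D.δ k)) + D.s k * u k x), ?_, ?_⟩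
  · have h2 : ∀ k, AnalyticAt ℂ (fun y => D.L.weierstrassP (y - D.δ k)) (D.halfPeriod i) :=
      fun k => AnalyticAt.fun_comp (g := D.L.weierstrassP) (f := fun y => y - D.δ k)
        (D.L.analyticAt_weierstrassP (D.halfPeriod_sub_notMem hδ he i k)) (by fun_prop)
    have h3 : ∀ k, AnalyticAt ℂ (fun y => D.L.weierstrassP (y + D.δ k)) (D.halfPeriod i) :=
      fun k => AnalyticAt.fun_comp (g := D.L.weierstrassP) (f := fun y => y + D.δ k)
        (D.L.analyticAt_weierstrassP (D.halfPeriod_add_notMem hδ he i k)) (by fun_prop)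
    exact ((analyticAt_const.mul (D.analyticAt_weierstrassPExcept_sub _)).fun_add
      (Finset.analyticAt_fun_sum _ fun j hj => analyticAt_const.mul
        (D.analyticAt_weierstrassP_add_halfPeriod (Finset.ne_of_mem_erase hj).symm))).fun_add
      (Finset.analyticAt_fun_sum _ fun k _ =>
        (analyticAt_const.mul ((h2 k).add (h3 k))).fun_add (analyticAt_const.mul (hu k)))
  · filter_upwards [eventually_all.2 hueq] with x hx
    unfold v
    rw [← Finset.add_sum_erase _ _ (Finset.mem_univ i), D.weierstrassP_add_halfPeriod i]
    simp only [← hx]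
    simp only [mul_one_div]
    ring

lemma even_about_halfPeriod {Ξ : ℂ → ℂ} (hΞ : Ξ ∈ D.evenPeriodicSolutions) (i : Fin 4) (t : ℂ) :
    Ξ (D.halfPeriod i + t) = Ξ (D.halfPeriod i - t) := by
  obtain ⟨-, -, -, heven, h1, h2, -⟩ := hΞ
  have h3 := h1 (D.halfPeriod i - t)
  have h4 := h2 (D.halfPeriod i - t)
  have h5 := h1 (-(D.halfPeriod i + t))
  have h6 := h2 (-(D.halfPeriod i + t))
  have h7 := h2 (D.halfPeriod i - t + D.L.ω₁)
  rw [← heven (D.halfPeriod i + t)]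
  fin_cases i
  · simp [halfPeriod]
  · rw [← h5]; simp [halfPeriod]; ring_nf
  · rw [← h3, ← h7]; simp [halfPeriod]; ring_nf
  · rw [← h6]; simp [halfPeriod]; ring_nf

/-- If `Q ≠ 0`, then `Ξ` has a pole of order exactly `2 lᵢ` at `ωᵢ`. -/
theorem tendsto_pow_mul_at_halfPeriod (hδ : ∀ k, D.δ k ∉ D.L.lattice)
    (he : ∀ k, ∀ i, i ≠ 0 → D.L.weierstrassP (D.δ k) ≠ D.L.weierstrassP (D.halfPeriod i))
    {Ξ : ℂ → ℂ} (hΞ : Ξ ∈ D.evenPeriodicSolutions) {Q : ℂ}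
    (hQ : ∀ x ∈ D.regularSet, D.qExpr Ξ x = Q) (hQ0 : Q ≠ 0) (i : Fin 4) :
    ∃ a : ℂ, a ≠ 0 ∧ Tendsto (fun x => (x - D.halfPeriod i) ^ (2 * D.l i) * Ξ x)
      (𝓝[≠] (D.halfPeriod i)) (𝓝 a) := by
  obtain ⟨w, hw, hv⟩ := D.exists_v_eq_near_halfPeriod hδ he i
  refine tendsto_pow_mul_of_firstIntegral_ne_zero (hΞ.1 _) (D.even_about_halfPeriod hΞ i) hw hv ?_
    hQ0 (E := D.E)
  filter_upwards [D.eventually_mem_regularSet (D.halfPeriod i)] with x hx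
  rw [← hQ x hx]
  simp only [qExpr, iteratedDeriv_succ, iteratedDeriv_zero]

/-- The summands of the expansion in the poles over `δₖ` have a finite limit at each half period,
and this limit is `0` at the lattice point `0`. -/
lemma exists_tendsto_sum_div_pow
    (he : ∀ k, ∀ i, i ≠ 0 → D.L.weierstrassP (D.δ k) ≠ D.L.weierstrassP (D.halfPeriod i))
    (d : Fin M → ℕ → ℂ) (i : Fin 4) :
    ∃ c : ℂ, (i = 0 → c = 0) ∧ Tendsto (fun x => ∑ k, ∑ j ∈ Finset.range (D.r k),
      d k j / (D.L.weierstrassP x - D.L.weierstrassP (D.δ k)) ^ (D.r k - j))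
      (𝓝[≠] (D.halfPeriod i)) (𝓝 c) := by
  choose u hu hu0 hueq using fun k => D.exists_analyticAt_one_div_weierstrassP_sub he i k
  refine ⟨∑ k, ∑ j ∈ Finset.range (D.r k), d k j * u k (D.halfPeriod i) ^ (D.r k - j), ?_, ?_⟩
  · rintro rfl
    refine Finset.sum_eq_zero fun k _ => Finset.sum_eq_zero fun j hj => ?_
    have hj' : D.r k - j ≠ 0 := by have := Finset.mem_range.1 hj; lia
    rw [D.halfPeriod_zero, hu0 k rfl, zero_pow hj', mul_zero]
  · have hlim : Tendsto (fun x => ∑ k, ∑ j ∈ Finset.range (D.r k), d k j * u k x ^ (D.r k - j))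
        (𝓝[≠] (D.halfPeriod i))
        (𝓝 (∑ k, ∑ j ∈ Finset.range (D.r k), d k j * u k (D.halfPeriod i) ^ (D.r k - j))) :=
      tendsto_finsetSum _ fun k _ => tendsto_finsetSum _ fun j _ =>
        (((hu k).continuousAt.tendsto.mono_left nhdsWithin_le_nhds).pow _).const_mul _
    refine hlim.congr' ?_
    filter_upwards [eventually_all.2 hueq] with x hx
    refine Finset.sum_congr rfl fun k _ => Finset.sum_congr rfl fun j _ => ?_
    rw [← hx k, div_pow, one_pow, mul_one_div]

/-- The coefficient `bᵢ₀` is the leading coefficient of the expansion at `ωᵢ`. -/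
lemma tendsto_pow_mul_expansion
    (he : ∀ k, ∀ i, i ≠ 0 → D.L.weierstrassP (D.δ k) ≠ D.L.weierstrassP (D.halfPeriod i))
    (c₀ : ℂ) (b : Fin 4 → ℕ → ℂ) (d : Fin M → ℕ → ℂ) {i : Fin 4} (hi : D.l i ≠ 0) :
    Tendsto (fun x => (x - D.halfPeriod i) ^ (2 * D.l i) * D.expansion c₀ b d x)
      (𝓝[≠] (D.halfPeriod i)) (𝓝 (b i 0)) := by
  set p := D.halfPeriod i
  obtain ⟨c, -, hc⟩ := D.exists_tendsto_sum_div_pow he d i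
  have hsub : Tendsto (fun x : ℂ => x - p) (𝓝[≠] p) (𝓝 0) :=
    tendsto_nhdsWithin_of_tendsto_nhds (by simpa using (continuous_sub_right p).tendsto p)
  have hpow : ∀ m : ℕ, m ≠ 0 → Tendsto (fun x : ℂ => (x - p) ^ m) (𝓝[≠] p) (𝓝 0) :=
    fun m hm => by simpa [hm] using hsub.pow m
  have h2l : 2 * D.l i ≠ 0 := by lia
  have hone : Tendsto (fun x => (x - p) ^ 2 * D.L.weierstrassP (x + p)) (𝓝[≠] p) (𝓝 1) := by
    have h1 := ((hpow 2 two_ne_zero).mul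
      ((D.analyticAt_weierstrassPExcept_sub p).continuousAt.tendsto.mono_left
        nhdsWithin_le_nhds)).add_const 1
    rw [zero_mul, zero_add] at h1
    refine h1.congr' ?_
    filter_upwards [self_mem_nhdsWithin] with x hx
    have ht : x - p ≠ 0 := sub_ne_zero.2 hx
    rw [D.weierstrassP_add_halfPeriod i, mul_add, mul_one_div_cancel (pow_ne_zero 2 ht)]
  have hterm : ∀ i', ∀ j ∈ Finset.range (D.l i'), Tendsto (fun x => (x - p) ^ (2 * D.l i) *
      (b i' j * D.L.weierstrassP (x + D.halfPeriod i') ^ (D.l i' - j))) (𝓝[≠] p)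
      (𝓝 (if i' = i then if j = 0 then b i 0 else 0 else 0)) := by
    intro i' j hj
    rcases eq_or_ne i i' with rfl | hne
    · have hj' : j ≤ D.l i := (Finset.mem_range.1 hj).le
      have hfac : ∀ x, (x - p) ^ (2 * D.l i) * (b i j * D.L.weierstrassP (x + p) ^ (D.l i - j))
          = b i j * ((x - p) ^ (2 * j) *
            ((x - p) ^ 2 * D.L.weierstrassP (x + p)) ^ (D.l i - j)) := by
        intro x
        have : 2 * D.l i = 2 * j + 2 * (D.l i - j) := by lia
        rw [this, pow_add, mul_pow, ← pow_mul]
        ring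
      refine Tendsto.congr (fun x => (hfac x).symm) ?_
      rcases eq_or_ne j 0 with rfl | hj0
      · simpa using (hone.pow (D.l i)).const_mul (b i 0)
      · simpa [hj0] using ((hpow (2 * j) (by lia)).mul (hone.pow (D.l i - j))).const_mul (b i j)
    · have := (hpow _ h2l).mul ((((D.analyticAt_weierstrassP_add_halfPeriod
        hne).continuousAt.tendsto.mono_left nhdsWithin_le_nhds).pow (D.l i' - j)).const_mul
          (b i' j))
      simpa [hne.symm] using this
  have hsum := (((hpow _ h2l).mul_const c₀).add (tendsto_finsetSum Finset.univ fun i' _ =>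
    tendsto_finsetSum (Finset.range (D.l i')) (hterm i'))).add ((hpow _ h2l).mul hc)
  have hval : ∑ i', ∑ j ∈ Finset.range (D.l i'),
      (if i' = i then if j = 0 then b i 0 else 0 else 0) = b i 0 := by
    rw [Finset.sum_eq_single i (fun i' _ h => by simp [h]) (by simp)]
    simp [Nat.pos_of_ne_zero hi]
  rw [hval, zero_mul, zero_mul, zero_add, add_zero] at hsum
  refine hsum.congr fun x => ?_
  simp only [expansion, mul_add, Finset.mul_sum]

end EllipticSchrodinger

namespace EllipticSchrodinger

variable {M : ℕ} (D : EllipticSchrodinger M)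

/-! ### Squares of solutions of the second order equation -/

/-- The square of a solution of `f'' = (v - E) f` solves the third order equation, and its first
integral vanishes. -/
lemma ode_and_qExpr_of_eventuallyEq_sq {f F : ℂ → ℂ} {x : ℂ} (hx : x ∈ D.regularSet)
    (hf : AnalyticAt ℂ f x) (hsol : ∀ᶠ y in 𝓝 x, deriv (deriv f) y = (D.v y - D.E) * f y)
    (hF : F =ᶠ[𝓝 x] fun y => f y ^ 2) :
    iteratedDeriv 3 F x - 4 * (D.v x - D.E) * deriv F x - 2 * deriv D.v x * F x = 0 ∧
      D.qExpr F x = 0 := by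
  have hv := (D.analyticAt_v hx).differentiableAt.hasDerivAt
  have hf0 := hf.differentiableAt.hasDerivAt
  have hf1 : HasDerivAt (deriv f) ((D.v x - D.E) * f x) x := by
    rw [← hsol.self_of_nhds]
    exact hf.deriv.differentiableAt.hasDerivAt
  have d1 : deriv F =ᶠ[𝓝 x] fun y => 2 * f y * deriv f y := by
    filter_upwards [hF.eventually_nhds, hf.eventually_analyticAt] with y hy hfy
    refine (EventuallyEq.deriv_eq hy).trans ?_
    simpa using (hfy.differentiableAt.hasDerivAt.fun_pow 2).deriv
  have d2 : deriv (deriv F) =ᶠ[𝓝 x]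
      fun y => 2 * deriv f y ^ 2 + 2 * (D.v y - D.E) * f y ^ 2 := by
    filter_upwards [d1.eventually_nhds, hf.eventually_analyticAt, hsol] with y hy hfy hs
    refine (EventuallyEq.deriv_eq hy).trans ?_
    refine (((hfy.differentiableAt.hasDerivAt.const_mul 2).fun_mul
      hfy.deriv.differentiableAt.hasDerivAt).congr_deriv ?_).deriv
    rw [hs]
    ring
  have d3 : deriv (deriv (deriv F)) x
      = 8 * (D.v x - D.E) * f x * deriv f x + 2 * deriv D.v x * f x ^ 2 := by
    rw [d2.deriv_eq]
    refine ((((hf1.fun_pow 2).const_mul 2).fun_add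
      (((hv.sub_const D.E).const_mul 2).fun_mul (hf0.fun_pow 2))).congr_deriv ?_).deriv
    push_cast
    ring
  simp only [qExpr, iteratedDeriv_succ, iteratedDeriv_zero]
  rw [d3, d2.eq_of_nhds, d1.eq_of_nhds, hF.eq_of_nhds]
  constructor <;> ring

lemma qExpr_const_smul {Ξ : ℂ → ℂ} {x : ℂ} (hΞ : AnalyticAt ℂ Ξ x) (c : ℂ) :
    D.qExpr (c • Ξ) x = c ^ 2 * D.qExpr Ξ x := by
  have h1 : deriv (c • Ξ) x = c * deriv Ξ x := by
    rw [deriv_const_smul c hΞ.differentiableAt, smul_eq_mul]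
  have h2 : iteratedDeriv 2 (c • Ξ) x = c * iteratedDeriv 2 Ξ x := by
    rw [iteratedDeriv_const_smul hΞ.contDiffAt c, smul_eq_mul]
  simp only [qExpr, h1, h2, Pi.smul_apply, smul_eq_mul]
  ring

/-! ### Branches of the two-valued factor -/

/-- The single-valued square `∏ₖ (℘(x) - ℘(δₖ))^rₖ` of `Ψ_g`. -/
def psiSq (x : ℂ) : ℂ := ∏ k, (D.L.weierstrassP x - D.L.weierstrassP (D.δ k)) ^ D.r k

lemma psiSq_ne_zero {x : ℂ} (hx : x ∈ D.regularSet) : D.psiSq x ≠ 0 :=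
  Finset.prod_ne_zero_iff.2 fun k _ => pow_ne_zero _ (sub_ne_zero.2 (hx.2 k))

lemma analyticAt_psiSq {x : ℂ} (hx : x ∈ D.regularSet) : AnalyticAt ℂ D.psiSq x :=
  Finset.analyticAt_fun_prod _ fun _ _ =>
    ((D.L.analyticAt_weierstrassP (D.notMem_lattice_of_mem_regularSet hx)).fun_sub
      analyticAt_const).fun_pow _

lemma meromorphic_psiSq : Meromorphic D.psiSq := fun x =>
  MeromorphicAt.fun_prod fun _ _ =>
    ((D.L.meromorphic_weierstrassP x).fun_sub (MeromorphicAt.const _ x)).fun_pow _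

lemma psiSq_neg (x : ℂ) : D.psiSq (-x) = D.psiSq x := by
  simp [psiSq]

lemma psiSq_add {w : ℂ} (hw : w ∈ D.L.lattice) (x : ℂ) : D.psiSq (x + w) = D.psiSq x := by
  have : D.L.weierstrassP (x + w) = D.L.weierstrassP x := D.L.weierstrassP_add_coe x ⟨w, hw⟩
  simp [psiSq, this]

variable {D} in
lemma IsPsiBranch.ne_zero {U : Set ℂ} {ψ : ℂ → ℂ} (h : D.IsPsiBranch U ψ)
    (hU : U ⊆ D.regularSet) {x : ℂ} (hx : x ∈ U) : ψ x ≠ 0 := by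
  intro h0
  have := h.2 x hx
  rw [h0, zero_pow two_ne_zero] at this
  exact D.psiSq_ne_zero (hU hx) this.symm

/-- Near a regular point `x` the product `psiSq` has no zeros, and a holomorphic square root of it
is `√(psiSq x) · exp (½ log (psiSq / psiSq x))`. -/
lemma exists_isPsiBranch {x : ℂ} (hx : x ∈ D.regularSet) :
    ∃ (U : Set ℂ) (ψ : ℂ → ℂ), IsOpen U ∧ x ∈ U ∧ U ⊆ D.regularSet ∧ D.IsPsiBranch U ψ := by
  obtain ⟨s, hs⟩ := IsAlgClosed.exists_pow_nat_eq (D.psiSq x) two_pos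
  have hx0 := D.psiSq_ne_zero hx
  have han : AnalyticOnNhd ℂ (fun y => D.psiSq y / D.psiSq x) D.regularSet := fun y hy =>
    (D.analyticAt_psiSq hy).div_const
  refine ⟨D.regularSet ∩ (fun y => D.psiSq y / D.psiSq x) ⁻¹' Complex.slitPlane,
    fun y => Complex.exp (1 / 2 * Complex.log (D.psiSq y / D.psiSq x)) * s,
    han.continuousOn.isOpen_inter_preimage D.isOpen_regularSet Complex.isOpen_slitPlane,
    ⟨hx, by simp [hx0]⟩, Set.inter_subset_left, fun y hy => ?_, fun y hy => ?_⟩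
  · have := (han y hy.1).clog hy.2
    exact (analyticAt_const.mul this).cexp'.mul analyticAt_const
  · have hq : D.psiSq y / D.psiSq x ≠ 0 := div_ne_zero (D.psiSq_ne_zero hy.1) hx0
    rw [mul_pow, hs, ← Complex.exp_nat_mul, Nat.cast_ofNat, ← mul_assoc, mul_one_div_cancel
      two_ne_zero, one_mul, Complex.exp_log hq, div_mul_cancel₀ _ hx0, psiSq]

/-! ### Solutions in the spaces of quasi-periodic functions -/

variable {D}

/-- The potential is even, so reflection `x ↦ -x` preserves the solutions. -/
lemma QuotientSolves.comp_neg {g : ℂ → ℂ} (hg : D.QuotientSolves g) :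
    D.QuotientSolves fun x => g (-x) := by
  intro U ψ hU hUr hψ x hx
  have hsol := hg (-U) (fun y => ψ (-y)) hU.neg (fun y hy => D.neg_mem_regularSet_iff.1 (hUr hy))
    ⟨fun y hy => AnalyticAt.fun_comp (g := ψ) (f := fun y => -y) (hψ.1 (-y) hy) (by fun_prop),
      fun y hy => (hψ.2 (-y) hy).trans (D.psiSq_neg y)⟩ (-x) (by simpa using hx)
  have h2 : ∀ F : ℂ → ℂ, deriv (deriv fun y => F (-y)) x = deriv (deriv F) (-x) := by
    intro F
    have : (deriv fun y => F (-y)) = fun y => -deriv F (-y) := funext fun y => deriv_comp_neg F y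
    rw [this, deriv.fun_neg, deriv_comp_neg, neg_neg]
  have h3 := h2 fun y => g y / ψ (-y)
  simp only [iteratedDeriv_succ, iteratedDeriv_zero, neg_neg, D.v_neg] at hsol h3 ⊢
  rw [h3]
  exact hsol

lemma QuotientSolves.add_const_mul {g₁ g₂ : ℂ → ℂ} (h₁ : D.QuotientSolves g₁)
    (h₂ : D.QuotientSolves g₂) (hg₁ : AnalyticOnNhd ℂ g₁ D.regularSet)
    (hg₂ : AnalyticOnNhd ℂ g₂ D.regularSet) (c : ℂ) :
    D.QuotientSolves fun x => g₁ x + c * g₂ x := by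
  intro U ψ hU hUr hψ x hx
  have e₁ := h₁ U ψ hU hUr hψ x hx
  have e₂ := h₂ U ψ hU hUr hψ x hx
  have a₁ : AnalyticAt ℂ (fun y => g₁ y / ψ y) x :=
    (hg₁ x (hUr hx)).fun_div (hψ.1 x hx) (hψ.ne_zero hUr hx)
  have a₂ : AnalyticAt ℂ (fun y => g₂ y / ψ y) x :=
    (hg₂ x (hUr hx)).fun_div (hψ.1 x hx) (hψ.ne_zero hUr hx)
  have hfun : (fun y => (g₁ y + c * g₂ y) / ψ y)
      = (fun y => g₁ y / ψ y) + c • fun y => g₂ y / ψ y := by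
    funext y
    simp only [Pi.add_apply, Pi.smul_apply, smul_eq_mul]
    ring
  have hval := congrFun hfun x
  simp only [Pi.add_apply, Pi.smul_apply, smul_eq_mul] at hval
  have hadd := iteratedDeriv_add (n := 2) (g := c • fun y => g₂ y / ψ y) a₁.contDiffAt
    (a₂.contDiffAt.const_smul c)
  rw [hfun, hadd, iteratedDeriv_const_smul a₂.contDiffAt c, smul_eq_mul]
  dsimp only
  rw [hval]
  linear_combination e₁ + c * e₂

variable (D) in
/-- The square of `f = G / Ψ_g`, extended by zero from the regular set. -/
def quotientSq (G : ℂ → ℂ) : ℂ → ℂ := D.regularSet.indicator fun x => G x ^ 2 / D.psiSq x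

lemma QuotientSolves.ode_and_qExpr_quotientSq {G : ℂ → ℂ} (hG : D.QuotientSolves G)
    (han : AnalyticOnNhd ℂ G D.regularSet) {x : ℂ} (hx : x ∈ D.regularSet) :
    iteratedDeriv 3 (D.quotientSq G) x - 4 * (D.v x - D.E) * deriv (D.quotientSq G) x
      - 2 * deriv D.v x * D.quotientSq G x = 0 ∧ D.qExpr (D.quotientSq G) x = 0 := by
  obtain ⟨U, ψ, hU, hxU, hUr, hψ⟩ := D.exists_isPsiBranch hx
  refine D.ode_and_qExpr_of_eventuallyEq_sq hx (f := fun y => G y / ψ y)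
    ((han x hx).fun_div (hψ.1 x hxU) (hψ.ne_zero hUr hxU)) ?_ ?_
  · filter_upwards [hU.mem_nhds hxU] with y hy
    have := hG U ψ hU hUr hψ y hy
    simp only [iteratedDeriv_succ, iteratedDeriv_zero] at this
    linear_combination -this
  · filter_upwards [hU.mem_nhds hxU] with y hy
    rw [quotientSq, Set.indicator_of_mem (hUr hy), div_pow, hψ.2 y hy, psiSq]

lemma QuotientSolves.quotientSq_mem {G : ℂ → ℂ} (hG : D.QuotientSolves G)
    (hmer : Meromorphic G) (han : AnalyticOnNhd ℂ G D.regularSet)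
    (hneg : ∀ x, G (-x) ^ 2 = G x ^ 2)
    (h1 : ∀ x ∈ D.regularSet, G (x + D.L.ω₁) ^ 2 = G x ^ 2)
    (h3 : ∀ x ∈ D.regularSet, G (x + D.L.ω₂) ^ 2 = G x ^ 2) :
    D.quotientSq G ∈ D.evenPeriodicSolutions := by
  have hper : ∀ w ∈ D.L.lattice, (∀ x ∈ D.regularSet, G (x + w) ^ 2 = G x ^ 2) →
      ∀ x, D.quotientSq G (x + w) = D.quotientSq G x := by
    intro w hw hGw x
    by_cases hx : x ∈ D.regularSet
    · rw [quotientSq, Set.indicator_of_mem hx, Set.indicator_of_mem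
        ((D.add_mem_regularSet_iff hw).2 hx), hGw x hx, D.psiSq_add hw]
    · rw [quotientSq, Set.indicator_of_notMem hx, Set.indicator_of_notMem
        ((D.add_mem_regularSet_iff hw).not.2 hx)]
  refine ⟨fun x => ?_, fun x hx => ?_, fun x hx => Set.indicator_of_notMem hx _, fun x => ?_,
    hper _ D.L.ω₁_mem_lattice h1, hper _ D.L.ω₂_mem_lattice h3,
    fun x hx => (hG.ode_and_qExpr_quotientSq han hx).1⟩
  · refine (((hmer x).fun_pow 2).fun_div (D.meromorphic_psiSq x)).congr ?_
    filter_upwards [D.eventually_mem_regularSet x] with y hy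
    exact (Set.indicator_of_mem hy (fun x => G x ^ 2 / D.psiSq x)).symm
  · refine (((han x hx).fun_pow 2).fun_div (D.analyticAt_psiSq hx) (D.psiSq_ne_zero hx)).congr ?_
    filter_upwards [D.isOpen_regularSet.mem_nhds hx] with y hy
    exact (Set.indicator_of_mem hy (fun x => G x ^ 2 / D.psiSq x)).symm
  · by_cases hx : x ∈ D.regularSet
    · rw [quotientSq, Set.indicator_of_mem hx, Set.indicator_of_mem
        (D.neg_mem_regularSet_iff.2 hx), hneg, D.psiSq_neg]
    · rw [quotientSq, Set.indicator_of_notMem hx, Set.indicator_of_notMem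
        (D.neg_mem_regularSet_iff.not.2 hx)]

/-- A nonzero solution `g / Ψ_g` yields a nonzero even doubly-periodic solution of the third order
equation with vanishing first integral: the square of its even or of its odd part. -/
theorem MemTildeF.exists_mem_evenPeriodicSolutions {ε₁ ε₃ : ℤˣ} {g : ℂ → ℂ}
    (hg : D.MemTildeF ε₁ ε₃ g) (hne : ∃ x ∈ D.regularSet, g x ≠ 0) (hsol : D.QuotientSolves g) :
    ∃ F ∈ D.evenPeriodicSolutions, F ≠ 0 ∧ ∀ x ∈ D.regularSet, D.qExpr F x = 0 := by
  obtain ⟨x₀, hx₀, hgx₀⟩ := hne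
  have han : AnalyticOnNhd ℂ g D.regularSet := fun x hx => hg.holomorphic x hx.1
  have han' : AnalyticOnNhd ℂ (fun x => g (-x)) D.regularSet := fun x hx =>
    AnalyticAt.fun_comp (g := g) (f := fun y => -y) (han (-x) (D.neg_mem_regularSet_iff.2 hx))
      (by fun_prop)
  -- `g (x₀)` is half the sum of `g (x₀) ± g (-x₀)`, so one of the two signs `σ` works.
  obtain ⟨σ, hσ, hσ0⟩ : ∃ σ : ℂ, σ ^ 2 = 1 ∧ g x₀ + σ * g (-x₀) ≠ 0 := by
    by_contra! hcon
    have h1 := hcon 1 (by norm_num)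
    have h2 := hcon (-1) (by norm_num)
    exact hgx₀ (by linear_combination (h1 + h2) / 2)
  set G : ℂ → ℂ := fun x => g x + σ * g (-x) with hGdef
  have hGan : AnalyticOnNhd ℂ G D.regularSet := fun x hx =>
    (han x hx).fun_add (analyticAt_const.mul (han' x hx))
  have hGsol : D.QuotientSolves G := hsol.add_const_mul hsol.comp_neg han han' σ
  have hGmer : Meromorphic G := fun x =>
    (hg.meromorphic x).fun_add ((MeromorphicAt.const σ x).fun_mul
      ((hg.meromorphic (-x)).comp_analyticAt (g := fun y => -y) (by fun_prop)))
  have hGneg : ∀ x, G (-x) ^ 2 = G x ^ 2 := by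
    intro x
    simp only [hGdef, neg_neg]
    linear_combination (g x ^ 2 - g (-x) ^ 2) * hσ
  have hper : ∀ (ε : ℤˣ) (w : ℂ), w ∈ D.L.lattice →
      (∀ x, x ∉ D.halfLattice → g (x + w) = ((ε : ℤ) : ℂ) * g x) →
      ∀ x ∈ D.regularSet, G (x + w) ^ 2 = G x ^ 2 := by
    intro ε w hw hgw x hx
    have hε : ((ε : ℤ) : ℂ) ^ 2 = 1 := by
      rcases Int.units_eq_one_or ε with rfl | rfl <;> simp
    have hx' : -(x + w) ∉ D.halfLattice := by
      rw [D.neg_mem_halfLattice_iff, D.add_mem_halfLattice_iff hw]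
      exact hx.1
    have e1 := hgw x hx.1
    have e2 := hgw _ hx'
    rw [show -(x + w) + w = -x by ring] at e2
    have e3 : g (-(x + w)) = ((ε : ℤ) : ℂ) * g (-x) := by
      rw [e2, ← mul_assoc, ← sq, hε, one_mul]
    simp only [hGdef, e1, e3]
    linear_combination (g x + σ * g (-x)) ^ 2 * hε
  refine ⟨D.quotientSq G, hGsol.quotientSq_mem hGmer hGan hGneg
    (hper ε₁ _ D.L.ω₁_mem_lattice hg.period_one) (hper ε₃ _ D.L.ω₂_mem_lattice hg.period_three),
    fun h0 => ?_, fun x hx => (hGsol.ode_and_qExpr_quotientSq hGan hx).2⟩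
  have := congrFun h0 x₀
  rw [quotientSq, Set.indicator_of_mem hx₀] at this
  exact div_ne_zero (pow_ne_zero 2 hσ0) (D.psiSq_ne_zero hx₀) this

end EllipticSchrodinger

end

/-! ### Vanishing of the first integral and leading coefficients -/

theorem mainTheorem9 {M : ℕ} (D : EllipticSchrodinger M)
    (hr : ∀ k, 0 < D.r k)
    (hδ : ∀ k, D.δ k ∉ D.L.lattice)
    (he : ∀ k, ∀ i, i ≠ 0 → D.L.weierstrassP (D.δ k) ≠ D.L.weierstrassP (D.halfPeriod i))
    (hb : Function.Injective fun k => D.L.weierstrassP (D.δ k))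
    (hdim : Module.finrank ℂ D.evenPeriodicSolutions = 1)
    (Ξ : ℂ → ℂ) (hΞ : Ξ ∈ D.evenPeriodicSolutions) (hΞ0 : Ξ ≠ 0) :
    ∃ Q : ℂ, (∀ x ∈ D.regularSet, D.qExpr Ξ x = Q) ∧
      -- (i)
      ((∃ (ε₁ ε₃ : ℤˣ) (g : ℂ → ℂ), D.MemTildeF ε₁ ε₃ g ∧ (∃ x ∈ D.regularSet, g x ≠ 0) ∧
          D.QuotientSolves g) → Q = 0) ∧
      -- (ii)
      (∀ (c₀ : ℂ) (b : Fin 4 → ℕ → ℂ) (d : Fin M → ℕ → ℂ),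
        (∀ x ∈ D.regularSet, Ξ x = D.expansion c₀ b d x) →
          Q ≠ 0 → ∀ i, D.l i ≠ 0 → b i 0 ≠ 0) ∧
      -- (iii)
      (Q ≠ 0 → D.l 0 = 0 → ∃ a : ℂ, a ≠ 0 ∧ Tendsto Ξ (𝓝[≠] 0) (𝓝 a)) ∧
      (∀ (c₀ : ℂ) (b : Fin 4 → ℕ → ℂ) (d : Fin M → ℕ → ℂ),
        (∀ x ∈ D.regularSet, Ξ x = D.expansion c₀ b d x) →
          Q ≠ 0 → (∀ i, D.l i = 0) → c₀ ≠ 0) := by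
  obtain ⟨Q, hQ⟩ := D.exists_qExpr_eq hΞ
  have hlim : Q ≠ 0 → D.l 0 = 0 → ∃ a : ℂ, a ≠ 0 ∧ Tendsto Ξ (𝓝[≠] 0) (𝓝 a) := by
    intro hQ0 hl
    simpa [hl] using D.tendsto_pow_mul_at_halfPeriod hδ he hΞ hQ hQ0 0
  refine ⟨Q, hQ, ?_, ?_, hlim, ?_⟩
  · rintro ⟨ε₁, ε₃, g, hg, hne, hsol⟩
    obtain ⟨F, hF, hF0, hFQ⟩ := hg.exists_mem_evenPeriodicSolutions hne hsol
    obtain ⟨c, hc⟩ := (finrank_eq_one_iff_of_nonzero'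
      (⟨Ξ, hΞ⟩ : D.evenPeriodicSolutions) (by simpa using hΞ0)).1 hdim ⟨F, hF⟩
    have hcF : c • Ξ = F := congrArg Subtype.val hc
    have hc0 : c ≠ 0 := by
      rintro rfl
      exact hF0 (by rw [← hcF, zero_smul])
    obtain ⟨x, hx⟩ := D.isConnected_regularSet.nonempty
    have h := hFQ x hx
    rw [← hcF, D.qExpr_const_smul (hΞ.2.1 x hx), hQ x hx] at h
    exact (mul_eq_zero.1 h).resolve_left (pow_ne_zero 2 hc0)
  · intro c₀ b d hexp hQ0 i hi
    obtain ⟨a, ha, hta⟩ := D.tendsto_pow_mul_at_halfPeriod hδ he hΞ hQ hQ0 i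
    have hb0 := (D.tendsto_pow_mul_expansion he c₀ b d hi).congr' (f₂ := fun x =>
      (x - D.halfPeriod i) ^ (2 * D.l i) * Ξ x) (by
        filter_upwards [D.eventually_mem_regularSet (D.halfPeriod i)] with x hx
        rw [hexp x hx])
    rwa [tendsto_nhds_unique hb0 hta]
  · intro c₀ b d hexp hQ0 hl
    obtain ⟨a, ha, hta⟩ := hlim hQ0 (hl 0)
    obtain ⟨c, hc0, hc⟩ := D.exists_tendsto_sum_div_pow he d 0
    rw [hc0 rfl, D.halfPeriod_zero] at hc
    have hc₀ : Tendsto Ξ (𝓝[≠] 0) (𝓝 c₀) := by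
      have := hc.const_add c₀
      rw [add_zero] at this
      refine this.congr' ?_
      filter_upwards [D.eventually_mem_regularSet 0] with x hx
      rw [hexp x hx]
      simp [EllipticSchrodinger.expansion, hl]
    rwa [tendsto_nhds_unique hc₀ hta]
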